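/- Consider algebras $\mathbf L=\langle L,\vee,\wedge,\to,{}',0,1\rangle$ of type $(2,2,2,1,0,0)$. A *dually Stone Heyting algebra* is such an algebra in which $\langle L,\vee,\wedge,\to,0,1\rangle$ is a Heyting algebra and which satisfies $0'\approx 1$, $1'\approx 0$, $(x\wedge y)'\approx x'\vee y'$, $(x\vee y)''\approx x''\vee y''$, $x''\le x$ and $x'\wedge x''\approx 0$; it is a *dually Stone Heyting chain* if moreover its lattice reduct is a chain. A *variety* is a class of algebras closed under homomorphic images, subalgebras and arbitrary (possibly empty) direct products, and $\mathbf V(\mathcal K)$ denotes the smallest variety containing $\mathcal K$. Let $\mathbf{DStHC}$ be the variety generated by all dually Stone Heyting chains, and for $n\ge 1$ let $\mathbf C_n^{dp}$ be the $n$-element dually Stone Heyting chain: the $n$-element chain with $x\to y=1$ if $x\le y$ and $x\to y=y$ otherwise, $1'=0$, and $x'=1$ for $x\ne 1$. **Theorem.** The lattice of subvarieties of $\mathbf{DStHC}$, ordered by inclusion, is the following $\omega+1$-chain: $$\mathbf V(\mathbf C_1^{dp})<\mathbf V(\mathbf C_2^{dp})<\cdots<\mathbf V(\mathbf C_n^{dp})<\cdots<\mathbf{DStHC};$$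 that is, these varieties are pairwise distinct, ordered by inclusion as displayed, and are all the subvarieties of $\mathbf{DStHC}$. Moreover, an algebra $\mathbf A\in\mathbf{DStHC}$ is subdirectly irreducible if and only if it is a dually Stone Heyting chain, and $\mathbf{DStHC}$ is generated by the finite dually Stone Heyting chains. (Here $\mathbf A$ is subdirectly irreducible if for every subdirect embedding of $\mathbf A$ into the product of a nonempty family of algebras, one of the projections restricts to an isomorphism from $\mathbf A$ onto that factor; so one-element algebras are subdirectly irreducible.) -/

import Mathlib

universe u

/-- An algebra `⟨L, ∨, ∧, →, ', 0, 1⟩` of type `(2, 2, 2, 1, 0, 0)`; no identities are assumed. -/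
structure DAlg : Type (u + 1) where
  carrier : Type u
  join : carrier → carrier → carrier
  meet : carrier → carrier → carrier
  imp : carrier → carrier → carrier
  prime : carrier → carrier
  zero : carrier
  one : carrier

namespace DAlg

instance : CoeSort DAlg.{u} (Type u) := ⟨carrier⟩

/-- The join, meet, `0` and `1` form a bounded lattice. -/
structure IsBoundedLattice (L : DAlg.{u}) : Prop where
  join_comm : ∀ x y : L, L.join x y = L.join y x
  meet_comm : ∀ x y : L, L.meet x y = L.meet y x
  join_assoc : ∀ x y z : L, L.join (L.join x y) z = L.join x (L.join y z)
  meet_assoc : ∀ x y z : L, L.meet (L.meet x y) z = L.meet x (L.meet y z)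
  join_meet_self : ∀ x y : L, L.join x (L.meet x y) = x
  meet_join_self : ∀ x y : L, L.meet x (L.join x y) = x
  join_zero : ∀ x : L, L.join x L.zero = x
  meet_one : ∀ x : L, L.meet x L.one = x

/-- Semi-Heyting algebras (the operation `'` is ignored). -/
structure IsSemiHeyting (L : DAlg.{u}) : Prop extends L.IsBoundedLattice where
  meet_imp : ∀ x y : L, L.meet x (L.imp x y) = L.meet x y
  meet_imp_meet : ∀ x y z : L,
    L.meet x (L.imp y z) = L.meet x (L.imp (L.meet x y) (L.meet x z))
  imp_self : ∀ x : L, L.imp x x = L.one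

/-- Heyting algebras, as semi-Heyting algebras with `(x ∧ y) → y ≈ 1`. -/
structure IsHeyting (L : DAlg.{u}) : Prop extends L.IsSemiHeyting where
  meet_imp_right : ∀ x y : L, L.imp (L.meet x y) y = L.one

/-- Dually quasi-De Morgan semi-Heyting algebras; `prime_prime_le` is `x'' ≤ x`. -/
structure IsDQD (L : DAlg.{u}) : Prop extends L.IsSemiHeyting where
  prime_zero : L.prime L.zero = L.one
  prime_one : L.prime L.one = L.zero
  prime_meet : ∀ x y : L, L.prime (L.meet x y) = L.join (L.prime x) (L.prime y)
  prime_prime_join : ∀ x y : L, L.prime (L.prime (L.join x y)) =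
    L.join (L.prime (L.prime x)) (L.prime (L.prime y))
  prime_prime_le : ∀ x : L, L.meet (L.prime (L.prime x)) x = L.prime (L.prime x)

/-- Dually Stone semi-Heyting algebras: `x' ∧ x'' ≈ 0`. -/
structure IsDSt (L : DAlg.{u}) : Prop extends L.IsDQD where
  dual_stone : ∀ x : L, L.meet (L.prime x) (L.prime (L.prime x)) = L.zero

/-- Dually Stone Heyting chains: dually Stone algebras whose semi-Heyting reduct is a Heyting
algebra and whose lattice reduct is a chain (`x ≤ y` means `x ∧ y = x`). -/
structure IsDStHChain (L : DAlg.{u}) : Prop where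
  dst : L.IsDSt
  heyting : L.IsHeyting
  total : ∀ x y : L, L.meet x y = x ∨ L.meet y x = y

/-- Homomorphisms. -/
structure Hom (A B : DAlg.{u}) where
  toFun : A → B
  map_join : ∀ x y, toFun (A.join x y) = B.join (toFun x) (toFun y)
  map_meet : ∀ x y, toFun (A.meet x y) = B.meet (toFun x) (toFun y)
  map_imp : ∀ x y, toFun (A.imp x y) = B.imp (toFun x) (toFun y)
  map_prime : ∀ x, toFun (A.prime x) = B.prime (toFun x)
  map_zero : toFun A.zero = B.zero
  map_one : toFun A.one = B.one

/-- Direct products, with componentwise operations. -/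
def pi {ι : Type u} (A : ι → DAlg.{u}) : DAlg.{u} where
  carrier := ∀ i, A i
  join x y := fun i => (A i).join (x i) (y i)
  meet x y := fun i => (A i).meet (x i) (y i)
  imp x y := fun i => (A i).imp (x i) (y i)
  prime x := fun i => (A i).prime (x i)
  zero := fun i => (A i).zero
  one := fun i => (A i).one

/-- A variety: a class of algebras closed under homomorphic images, (isomorphic copies of)
subalgebras and arbitrary direct products. The empty product is allowed, so that a variety
contains the one-element algebras. -/
structure IsVariety (V : Set DAlg.{u}) : Prop where
  image : ∀ (A B : DAlg.{u}) (f : Hom A B), Function.Surjective f.toFun → A ∈ V → B ∈ V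
  subalgebra : ∀ (A B : DAlg.{u}) (f : Hom A B), Function.Injective f.toFun → B ∈ V → A ∈ V
  product : ∀ (ι : Type u) (A : ι → DAlg.{u}), (∀ i, A i ∈ V) → pi A ∈ V

/-- The variety generated by `K`: the intersection of all varieties that contain `K`. -/
def varietyGen (K : Set DAlg.{u}) : Set DAlg.{u} :=
  {A | ∀ V : Set DAlg.{u}, IsVariety V → K ⊆ V → A ∈ V}

/-- The variety generated by the dually Stone Heyting chains. -/
def DStHC : Set DAlg.{u} := varietyGen {A | A.IsDStHChain}

/-- The poset, under inclusion, of subvarieties of `W`. -/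
abbrev Subvariety (W : Set DAlg.{u}) : Type (u + 1) :=
  {V : Set DAlg.{u} // IsVariety V ∧ V ⊆ W}

/-- The `n`-element dually Stone Heyting chain, `n ≥ 1`: the set `{0 < ⋯ < n - 1}` (lifted to the
universe at hand) with `x → y = 1` if `x ≤ y`, `x → y = y` otherwise, and with `1' = 0`,
`x' = 1` for `x ≠ 1`. -/
noncomputable def chainDP (n : ℕ) [NeZero n] : DAlg.{u} where
  carrier := ULift.{u} (Fin n)
  join x y := ⟨max x.down y.down⟩
  meet x y := ⟨min x.down y.down⟩
  imp x y := if x.down ≤ y.down then ⟨⊤⟩ else y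
  prime x := if x.down = ⊤ then ⟨⊥⟩ else ⟨⊤⟩
  zero := ⟨⊥⟩
  one := ⟨⊤⟩

/-- Subdirect irreducibility: whenever `A` is subdirectly embedded into a product of a nonempty
family, one of the projections is an isomorphism. One-element algebras count as subdirectly
irreducible. -/
def IsSubdirectlyIrreducible (A : DAlg.{u}) : Prop :=
  ∀ (ι : Type u) (B : ι → DAlg.{u}) (f : Hom A (pi B)), Nonempty ι →
    Function.Injective f.toFun →
    (∀ i, Function.Surjective fun a => f.toFun a i) →
    ∃ i, Function.Bijective fun a => f.toFun a i

end DAlg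

/-!
Every algebra of `DStHC` is a subdirect product of chains, and chains are simple; all claims follow
from these two facts.

For the first, let `IsPrelinear` be the class of dually Stone Heyting algebras with
`(x → y) ∨ (y → x) ≈ 1`. It is a variety and contains the chains. In such an algebra
`x ↦ x''` preserves meets and joins and is idempotent, and `x'` is a complement of `x''`; so the
preimage of a prime filter under `x ↦ x''` is a prime filter `P` closed under `x ↦ x''`. The
relation `x → y, y → x ∈ P` is then a congruence (`IsPrimeNormalFilter.exists_quotient`; the
operation `'` is respected because `(x → y)'' ∧ y' ≤ x'`), and prelinearity makes the quotient a
chain. Since `c'' ≤ c`, the prime filter theorem gives for each `c ≠ 1` such a `P` that omits `c`,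
hence `IsPrelinear.exists_chain_separating` and `DStHC_eq_isPrelinear`.

For the second, the order of a dually Stone Heyting chain determines its operations
(`IsDStHChain.exists_eq_chainOf`), so that chains may be treated as bounded linear orders, and their
embeddings as order embeddings that preserve the bounds. If a homomorphism of a chain identifies
`y < x`, it maps `x → y = y` to `1`, and `y' = 1` to `1' = 0`. Hence chains are subdirectly
irreducible, and conversely a subdirectly irreducible algebra is one of its chain quotients.

A variety that contains all finite chains contains every chain, as a homomorphic image of the
eventually constant sequences in the product of its finite subchains
(`IsVariety.mem_of_finite_chains`). A subvariety is therefore determined by the set of `n` for which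
it contains the `n`-element chain. This set is downward closed, and the identity
`(x₀ → x₁) ∨ ⋯ ∨ (xₙ₋₁ → xₙ) ≈ 1`, which holds in a chain if and only if it has at most `n`
elements, separates the varieties that result.
-/

namespace DAlg

variable {A B : DAlg.{u}}

/-! ### Varieties -/

theorem isVariety_varietyGen (K : Set DAlg.{u}) : IsVariety (varietyGen K) where
  image A B f hf hA V hV hK := hV.image A B f hf (hA V hV hK)
  subalgebra A B f hf hB V hV hK := hV.subalgebra A B f hf (hB V hV hK)
  product ι A hA V hV hK := hV.product ι A fun i => hA i V hV hK

theorem subset_varietyGen (K : Set DAlg.{u}) : K ⊆ varietyGen K :=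
  fun _ hA _ _ hK => hK hA

theorem varietyGen_subset {K V : Set DAlg.{u}} (hV : IsVariety V) (hK : K ⊆ V) :
    varietyGen K ⊆ V :=
  fun _ hA => hA V hV hK

/-- The homomorphism into a product whose components are the given homomorphisms. -/
def Hom.toPi {ι : Type u} {B : ι → DAlg.{u}} (f : ∀ i, Hom A (B i)) : Hom A (pi B) where
  toFun a i := (f i).toFun a
  map_join _ _ := funext fun i => (f i).map_join _ _
  map_meet _ _ := funext fun i => (f i).map_meet _ _
  map_imp _ _ := funext fun i => (f i).map_imp _ _
  map_prime _ := funext fun i => (f i).map_prime _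
  map_zero := funext fun i => (f i).map_zero
  map_one := funext fun i => (f i).map_one

/-- An algebra whose points are separated by homomorphisms into members of a variety belongs to
the variety. -/
theorem IsVariety.mem_of_separated {V : Set DAlg.{u}} (hV : IsVariety V)
    (h : ∀ a b : A, a ≠ b → ∃ B ∈ V, ∃ f : Hom A B, f.toFun a ≠ f.toFun b) : A ∈ V := by
  choose B hB f hf using fun p : {p : A × A // p.1 ≠ p.2} => h p.1.1 p.1.2 p.2
  refine hV.subalgebra A (pi B) (Hom.toPi f) (fun a b hab => ?_) (hV.product _ B hB)
  by_contra hne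
  exact hf ⟨(a, b), hne⟩ (congrFun hab ⟨(a, b), hne⟩)

theorem IsVariety.mem_of_subsingleton {V : Set DAlg.{u}} (hV : IsVariety V)
    [Subsingleton A] : A ∈ V :=
  hV.mem_of_separated fun a b hab => (hab (Subsingleton.elim a b)).elim

/-! ### The variety of prelinear dually Stone Heyting algebras -/

/-- Dually Stone Heyting algebras that satisfy the prelinearity identity
`(x → y) ∨ (y → x) ≈ 1`. -/
structure IsPrelinear (L : DAlg.{u}) : Prop extends L.IsDSt, L.IsHeyting where
  prelinear : ∀ x y : L, L.join (L.imp x y) (L.imp y x) = L.one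

theorem IsPrelinear.image (f : Hom A B) (hf : Function.Surjective f.toFun)
    (h : A.IsPrelinear) : B.IsPrelinear := by
  constructor
  case toIsDSt =>
    refine ⟨⟨⟨⟨?_, ?_, ?_, ?_, ?_, ?_, ?_, ?_⟩, ?_, ?_, ?_⟩, ?_, ?_, ?_, ?_, ?_⟩, ?_⟩
    all_goals simp only [hf.forall, ← f.map_join, ← f.map_meet, ← f.map_imp, ← f.map_prime,
      ← f.map_zero, ← f.map_one]
    · exact fun x y => congrArg _ (h.join_comm x y)
    · exact fun x y => congrArg _ (h.meet_comm x y)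
    · exact fun x y z => congrArg _ (h.join_assoc x y z)
    · exact fun x y z => congrArg _ (h.meet_assoc x y z)
    · exact fun x y => congrArg _ (h.join_meet_self x y)
    · exact fun x y => congrArg _ (h.meet_join_self x y)
    · exact fun x => congrArg _ (h.join_zero x)
    · exact fun x => congrArg _ (h.meet_one x)
    · exact fun x y => congrArg _ (h.meet_imp x y)
    · exact fun x y z => congrArg _ (h.meet_imp_meet x y z)
    · exact fun x => congrArg _ (h.imp_self x)
    · exact congrArg _ h.prime_zero
    · exact congrArg _ h.prime_one
    · exact fun x y => congrArg _ (h.prime_meet x y)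
    · exact fun x y => congrArg _ (h.prime_prime_join x y)
    · exact fun x => congrArg _ (h.prime_prime_le x)
    · exact fun x => congrArg _ (h.dual_stone x)
  case meet_imp_right =>
    simp only [hf.forall, ← f.map_meet, ← f.map_imp, ← f.map_one]
    exact fun x y => congrArg _ (h.meet_imp_right x y)
  case prelinear =>
    simp only [hf.forall, ← f.map_join, ← f.map_imp, ← f.map_one]
    exact fun x y => congrArg _ (h.prelinear x y)

theorem IsPrelinear.subalgebra (f : Hom A B) (hf : Function.Injective f.toFun)
    (h : B.IsPrelinear) : A.IsPrelinear := by
  constructor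
  case toIsDSt =>
    refine ⟨⟨⟨⟨?_, ?_, ?_, ?_, ?_, ?_, ?_, ?_⟩, ?_, ?_, ?_⟩, ?_, ?_, ?_, ?_, ?_⟩, ?_⟩
    all_goals intros; apply hf; simp only [f.map_join, f.map_meet, f.map_imp, f.map_prime,
      f.map_zero, f.map_one]
    · exact h.join_comm _ _
    · exact h.meet_comm _ _
    · exact h.join_assoc _ _ _
    · exact h.meet_assoc _ _ _
    · exact h.join_meet_self _ _
    · exact h.meet_join_self _ _
    · exact h.join_zero _
    · exact h.meet_one _
    · exact h.meet_imp _ _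
    · exact h.meet_imp_meet _ _ _
    · exact h.imp_self _
    · exact h.prime_zero
    · exact h.prime_one
    · exact h.prime_meet _ _
    · exact h.prime_prime_join _ _
    · exact h.prime_prime_le _
    · exact h.dual_stone _
  case meet_imp_right =>
    intros; apply hf; simp only [f.map_meet, f.map_imp, f.map_one]
    exact h.meet_imp_right _ _
  case prelinear =>
    intros; apply hf; simp only [f.map_join, f.map_imp, f.map_one]
    exact h.prelinear _ _

theorem IsPrelinear.product {ι : Type u} {A : ι → DAlg.{u}} (h : ∀ i, (A i).IsPrelinear) :
    (pi A).IsPrelinear where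
  join_comm _ _ := funext fun i => (h i).join_comm _ _
  meet_comm _ _ := funext fun i => (h i).meet_comm _ _
  join_assoc _ _ _ := funext fun i => (h i).join_assoc _ _ _
  meet_assoc _ _ _ := funext fun i => (h i).meet_assoc _ _ _
  join_meet_self _ _ := funext fun i => (h i).join_meet_self _ _
  meet_join_self _ _ := funext fun i => (h i).meet_join_self _ _
  join_zero _ := funext fun i => (h i).join_zero _
  meet_one _ := funext fun i => (h i).meet_one _
  meet_imp _ _ := funext fun i => (h i).meet_imp _ _
  meet_imp_meet _ _ _ := funext fun i => (h i).meet_imp_meet _ _ _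
  imp_self _ := funext fun i => (h i).imp_self _
  prime_zero := funext fun i => (h i).prime_zero
  prime_one := funext fun i => (h i).prime_one
  prime_meet _ _ := funext fun i => (h i).prime_meet _ _
  prime_prime_join _ _ := funext fun i => (h i).prime_prime_join _ _
  prime_prime_le _ := funext fun i => (h i).prime_prime_le _
  dual_stone _ := funext fun i => (h i).dual_stone _
  meet_imp_right _ _ := funext fun i => (h i).meet_imp_right _ _
  prelinear _ _ := funext fun i => (h i).prelinear _ _

theorem isVariety_isPrelinear : IsVariety {A : DAlg.{u} | A.IsPrelinear} where
  image _ _ f hf h := IsPrelinear.image f hf h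
  subalgebra _ _ f hf h := IsPrelinear.subalgebra f hf h
  product _ _ h := IsPrelinear.product h

/-- The Heyting algebra of Mathlib carried by a Heyting algebra in the present signature. All its
operations are definitionally the given ones. -/
@[reducible]
def IsHeyting.heytingAlgebra (h : A.IsHeyting) : HeytingAlgebra A :=
  letI l : Lattice A := @Lattice.mk' A ⟨A.join⟩ ⟨A.meet⟩ h.join_comm h.join_assoc h.meet_comm
    h.meet_assoc h.join_meet_self h.meet_join_self
  { l with
    top := A.one
    bot := A.zero
    himp := A.imp
    compl := fun x => A.imp x A.zero
    le_top := fun x => inf_eq_left.1 (h.meet_one x)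
    bot_le := fun x => sup_eq_left.1 (h.join_zero x)
    le_himp_iff := fun x y z => by
      constructor
      · intro hx
        have h1 : A.meet x (A.imp y z) = x := inf_eq_left.2 hx
        have h2 : A.meet (A.meet x y) z = A.meet x y := by
          calc A.meet (A.meet x y) z = A.meet x (A.meet y (A.imp y z)) := by
                rw [h.meet_assoc, h.meet_imp]
            _ = A.meet (A.meet x (A.imp y z)) y := by
                rw [h.meet_comm y, h.meet_assoc]
            _ = A.meet x y := by rw [h1]
        exact inf_eq_left.1 h2
      · intro hx
        have h1 : A.meet (A.meet x y) (A.meet x z) = A.meet x y :=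
          inf_eq_left.2 (le_inf inf_le_left hx)
        have h2 : A.meet x (A.imp y z) = x := by
          rw [h.meet_imp_meet, ← h1, h.meet_imp_right, h.meet_one]
        exact inf_eq_left.1 h2
    himp_bot := fun _ => rfl }

/-! ### Separation of points by quotients that are chains -/

theorem IsDStHChain.isPrelinear (h : A.IsDStHChain) : A.IsPrelinear where
  toIsDSt := h.dst
  meet_imp_right := h.heyting.meet_imp_right
  prelinear x y := by
    let _ := h.heyting.heytingAlgebra
    change (x ⇨ y) ⊔ (y ⇨ x) = ⊤
    rcases h.total x y with hxy | hyx
    · rw [himp_eq_top_iff.2 (inf_eq_left.1 hxy), top_sup_eq]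
    · rw [himp_eq_top_iff.2 (inf_eq_left.1 hyx), sup_top_eq]

/-- A set `P` whose quotient is a chain: a prime filter, possibly improper, that
contains `x''` along with `x`. -/
structure IsPrimeNormalFilter (A : DAlg.{u}) (P : Set A) : Prop where
  one_mem : A.one ∈ P
  meet_mem : ∀ x ∈ P, ∀ y ∈ P, A.meet x y ∈ P
  mem_of_le : ∀ x ∈ P, ∀ y, A.meet x y = x → y ∈ P
  mem_or_mem : ∀ x y, A.join x y ∈ P → x ∈ P ∨ y ∈ P
  prime_prime_mem : ∀ x ∈ P, A.prime (A.prime x) ∈ P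

/-- The preimage under `x ↦ x''` of any prime filter is a prime normal filter, because this map
preserves meets and joins and is idempotent. -/
theorem IsPrelinear.exists_isPrimeNormalFilter (h : A.IsPrelinear) {c : A} (hc : c ≠ A.one) :
    ∃ P : Set A, A.IsPrimeNormalFilter P ∧ c ∉ P := by
  let _ := h.toIsHeyting.heytingAlgebra
  obtain ⟨p, hp⟩ : ∃ p : A → A, p = A.prime := ⟨_, rfl⟩
  have p_top : p ⊤ = ⊥ := by rw [hp]; exact h.prime_one
  have p_bot : p ⊥ = ⊤ := by rw [hp]; exact h.prime_zero
  have p_inf (x y : A) : p (x ⊓ y) = p x ⊔ p y := by rw [hp]; exact h.prime_meet x y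
  have pp_sup (x y : A) : p (p (x ⊔ y)) = p (p x) ⊔ p (p y) := by
    rw [hp]; exact h.prime_prime_join x y
  have pp_le (x : A) : p (p x) ≤ x := by rw [hp]; exact inf_eq_left.1 (h.prime_prime_le x)
  have p_inf_pp (x : A) : p x ⊓ p (p x) = ⊥ := by rw [hp]; exact h.dual_stone x
  have p_anti {x y : A} (hxy : x ≤ y) : p y ≤ p x := by
    have := p_inf x y
    rw [inf_eq_left.2 hxy] at this
    rw [this]
    exact le_sup_right
  have ppp (x : A) : p (p (p x)) = p x := le_antisymm (pp_le _) (p_anti (pp_le x))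
  have p_sup_pp (x : A) : p x ⊔ p (p x) = ⊤ := by
    have := p_inf (p x) (p (p x))
    rw [p_inf_pp, p_bot, ppp] at this
    rw [this, sup_comm]
  have pp_mono {x y : A} (hxy : x ≤ y) : p (p x) ≤ p (p y) := p_anti (p_anti hxy)
  have pp_inf (x y : A) : p (p x) ⊓ p (p y) ≤ p (p (x ⊓ y)) := by
    have h1 : p (p x) ⊓ p (p y) ⊓ p (x ⊓ y) = ⊥ := by
      rw [p_inf, inf_sup_left, eq_bot_iff]
      refine sup_le ?_ ?_
      · rw [← p_inf_pp x]
        exact le_inf inf_le_right (inf_le_left.trans inf_le_left)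
      · rw [← p_inf_pp y]
        exact le_inf inf_le_right (inf_le_left.trans inf_le_right)
    calc p (p x) ⊓ p (p y)
        = p (p x) ⊓ p (p y) ⊓ (p (x ⊓ y) ⊔ p (p (x ⊓ y))) := by rw [p_sup_pp, inf_top_eq]
      _ = p (p x) ⊓ p (p y) ⊓ p (p (x ⊓ y)) := by rw [inf_sup_left, h1, bot_sup_eq]
      _ ≤ p (p (x ⊓ y)) := inf_le_right
  have hdisj : Disjoint (Order.PFilter.principal (⊤ : A) : Set A)
      (Order.Ideal.principal (p (p c)) : Set A) := by
    rw [Set.disjoint_left]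
    intro x hx hx'
    have hx1 : ⊤ ≤ x := hx
    have hx2 : x ≤ p (p c) := hx'
    exact hc (top_le_iff.1 (hx1.trans (hx2.trans (pp_le c))))
  obtain ⟨J, hJ, hcJ, -⟩ := DistribLattice.prime_ideal_of_disjoint_filter_ideal hdisj
  refine ⟨{x | p (p x) ∉ J}, ⟨?_, ?_, ?_, ?_, ?_⟩, fun h => h (hcJ (le_refl (p (p c))))⟩
  · change p (p ⊤) ∉ J
    rw [p_top, p_bot]
    exact hJ.toIsProper.top_notMem
  · intro x hx y hy hxy
    rcases hJ.mem_or_mem (J.lower (pp_inf x y) hxy) with h1 | h1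
    exacts [hx h1, hy h1]
  · intro x hx y hxy hy
    exact hx (J.lower (pp_mono (inf_eq_left.1 hxy)) hy)
  · intro x y hxy
    by_contra! hcon
    simp only [Set.mem_ofPred_eq, not_not] at hcon
    refine hxy ?_
    change p (p (x ⊔ y)) ∈ J
    rw [pp_sup]
    exact J.sup_mem hcon.1 hcon.2
  · intro x hx
    rw [← hp]
    change p (p (p (p x))) ∉ J
    rwa [ppp]

/-- The quotient by a prime normal filter is a chain. -/
theorem IsPrimeNormalFilter.exists_quotient (h : A.IsPrelinear) {P : Set A}
    (hP : A.IsPrimeNormalFilter P) :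
    ∃ (C : DAlg.{u}) (f : Hom A C), C.IsDStHChain ∧ Function.Surjective f.toFun ∧
      ∀ x y, f.toFun x = f.toFun y ↔ A.imp x y ∈ P ∧ A.imp y x ∈ P := by
  let _ := h.toIsHeyting.heytingAlgebra
  have up {x y : A} (hx : x ∈ P) (hxy : x ≤ y) : y ∈ P := hP.mem_of_le x hx y (inf_eq_left.2 hxy)
  have mem_inf {x y : A} (hx : x ∈ P) (hy : y ∈ P) : x ⊓ y ∈ P := hP.meet_mem x hx y hy
  have trans {x y z : A} (hxy : x ⇨ y ∈ P) (hyz : y ⇨ z ∈ P) : x ⇨ z ∈ P :=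
    up (mem_inf hxy hyz) (himp_triangle x y z)
  have sup {x y z w : A} (hxy : x ⇨ y ∈ P) (hzw : z ⇨ w ∈ P) : x ⊔ z ⇨ y ⊔ w ∈ P := by
    refine up (mem_inf hxy hzw) ?_
    rw [le_himp_iff, inf_sup_left]
    refine sup_le_sup ?_ ?_
    · rw [← le_himp_iff]; exact inf_le_left
    · rw [← le_himp_iff]; exact inf_le_right
  have inf {x y z w : A} (hxy : x ⇨ y ∈ P) (hzw : z ⇨ w ∈ P) : x ⊓ z ⇨ y ⊓ w ∈ P := by
    refine up (mem_inf hxy hzw) ?_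
    rw [le_himp_iff]
    refine le_inf ?_ ?_
    · exact (inf_le_inf inf_le_left inf_le_left).trans himp_inf_le
    · exact (inf_le_inf inf_le_right inf_le_right).trans himp_inf_le
  have imp {x y z w : A} (hyx : y ⇨ x ∈ P) (hzw : z ⇨ w ∈ P) :
      (x ⇨ z) ⇨ (y ⇨ w) ∈ P := by
    refine up (mem_inf hyx hzw) ?_
    rw [le_himp_iff, le_himp_iff]
    have h1 : (y ⇨ x) ⊓ (z ⇨ w) ⊓ (x ⇨ z) ⊓ y ≤ x :=
      (inf_le_inf_right y (inf_le_left.trans inf_le_left)).trans himp_inf_le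
    have h2 : (y ⇨ x) ⊓ (z ⇨ w) ⊓ (x ⇨ z) ⊓ y ≤ z :=
      (le_inf (inf_le_left.trans inf_le_right) h1).trans himp_inf_le
    exact (le_inf (inf_le_left.trans (inf_le_left.trans inf_le_right)) h2).trans himp_inf_le
  have p_inf (x y : A) : A.prime (x ⊓ y) = A.prime x ⊔ A.prime y := h.prime_meet x y
  have p_anti {x y : A} (hxy : x ≤ y) : A.prime y ≤ A.prime x := by
    have := p_inf x y
    rw [inf_eq_left.2 hxy] at this
    rw [this]
    exact le_sup_right
  -- From `x ∧ (x → y) ≤ y` one gets `y' ≤ x' ∨ (x → y)'`, and `(x → y)''` is disjoint from the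
  -- second joinand.
  have prime {x y : A} (hxy : x ⇨ y ∈ P) : A.prime y ⇨ A.prime x ∈ P := by
    refine up (hP.prime_prime_mem _ hxy) ?_
    rw [le_himp_iff]
    have h1 : A.prime y ≤ A.prime x ⊔ A.prime (x ⇨ y) := by
      rw [← p_inf]
      exact p_anti inf_himp_le
    have h2 : A.prime (x ⇨ y) ⊓ A.prime (A.prime (x ⇨ y)) = ⊥ := h.dual_stone _
    refine (inf_le_inf_left _ h1).trans ?_
    rw [inf_sup_left, inf_comm _ (A.prime (x ⇨ y)), h2, sup_bot_eq]
    exact inf_le_right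
  let s : Setoid A :=
    { r := fun x y => x ⇨ y ∈ P ∧ y ⇨ x ∈ P
      iseqv :=
        { refl := fun x => by rw [himp_self]; exact ⟨hP.one_mem, hP.one_mem⟩
          symm := fun hxy => ⟨hxy.2, hxy.1⟩
          trans := fun hxy hyz => ⟨trans hxy.1 hyz.1, trans hyz.2 hxy.2⟩ } }
  let C : DAlg.{u} :=
    { carrier := Quotient s
      join := Quotient.map₂ A.join fun _ _ hx _ _ hy => ⟨sup hx.1 hy.1, sup hx.2 hy.2⟩
      meet := Quotient.map₂ A.meet fun _ _ hx _ _ hy => ⟨inf hx.1 hy.1, inf hx.2 hy.2⟩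
      imp := Quotient.map₂ A.imp fun _ _ hx _ _ hy => ⟨imp hx.2 hy.1, imp hx.1 hy.2⟩
      prime := Quotient.map A.prime fun _ _ hx => ⟨prime hx.2, prime hx.1⟩
      zero := Quotient.mk s A.zero
      one := Quotient.mk s A.one }
  let f : Hom A C :=
    { toFun := Quotient.mk s
      map_join := fun _ _ => rfl
      map_meet := fun _ _ => rfl
      map_imp := fun _ _ => rfl
      map_prime := fun _ => rfl
      map_zero := rfl
      map_one := rfl }
  have hf : Function.Surjective f.toFun := Quotient.mk_surjective
  have hle {x y : A} (hxy : x ⇨ y ∈ P) :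
      C.meet (f.toFun x) (f.toFun y) = f.toFun x := by
    rw [← f.map_meet]
    refine Quotient.sound ⟨?_, ?_⟩
    · exact up hP.one_mem (himp_eq_top_iff.2 (inf_le_left : x ⊓ y ≤ x)).ge
    · refine up hxy ?_
      change x ⇨ y ≤ x ⇨ x ⊓ y
      rw [himp_inf_distrib, himp_self, top_inf_eq]
  have hC : C.IsPrelinear := h.image f hf
  refine ⟨C, f, ⟨hC.toIsDSt, hC.toIsHeyting, ?_⟩, hf, fun x y => Quotient.eq⟩
  rw [hf.forall]
  intro x
  rw [hf.forall]
  intro y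
  exact (hP.mem_or_mem (A.imp x y) (A.imp y x) (by rw [h.prelinear]; exact hP.one_mem)).imp hle hle

/-- Every prelinear dually Stone Heyting algebra is a subdirect product of chains. -/
theorem IsPrelinear.exists_chain_separating (h : A.IsPrelinear) {a b : A} (hab : a ≠ b) :
    ∃ (C : DAlg.{u}) (f : Hom A C), C.IsDStHChain ∧ Function.Surjective f.toFun ∧
      f.toFun a ≠ f.toFun b := by
  let _ := h.toIsHeyting.heytingAlgebra
  have key : ∀ x y : A, A.imp x y ≠ A.one → ∃ (C : DAlg.{u}) (f : Hom A C), C.IsDStHChain ∧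
      Function.Surjective f.toFun ∧ f.toFun x ≠ f.toFun y := by
    intro x y hxy
    obtain ⟨P, hP, hxyP⟩ := h.exists_isPrimeNormalFilter hxy
    obtain ⟨C, f, hC, hf, hker⟩ := hP.exists_quotient h
    exact ⟨C, f, hC, hf, fun he => hxyP ((hker x y).1 he).1⟩
  by_cases h1 : A.imp a b = A.one
  · have h2 : A.imp b a ≠ A.one := fun h2 =>
      hab (le_antisymm (himp_eq_top_iff.1 h1) (himp_eq_top_iff.1 h2))
    obtain ⟨C, f, hC, hf, hne⟩ := key b a h2
    exact ⟨C, f, hC, hf, hne.symm⟩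
  · exact key a b h1

theorem DStHC_eq_isPrelinear : DStHC.{u} = {A | A.IsPrelinear} := by
  refine (varietyGen_subset isVariety_isPrelinear fun A hA =>
    IsDStHChain.isPrelinear hA).antisymm fun A hA => ?_
  refine (isVariety_varietyGen _).mem_of_separated fun a b hab => ?_
  obtain ⟨C, f, hC, -, hne⟩ := IsPrelinear.exists_chain_separating hA hab
  exact ⟨C, subset_varietyGen _ hC, f, hne⟩

/-! ### Chains as bounded linear orders -/

section Chains

variable {α β : Type u} [LinearOrder α] [BoundedOrder α] [LinearOrder β] [BoundedOrder β]

/-- The dually Stone Heyting chain on a bounded linear order, with `x → y = ⊤` if `x ≤ y` and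
`x → y = y` otherwise, `⊤' = ⊥` and `x' = ⊤` for `x ≠ ⊤`. -/
abbrev chainOf (α : Type u) [LinearOrder α] [BoundedOrder α] : DAlg.{u} where
  carrier := α
  join := max
  meet := min
  imp x y := if x ≤ y then ⊤ else y
  prime x := if x = ⊤ then ⊥ else ⊤
  zero := ⊥
  one := ⊤

theorem chainDP_eq_chainOf (n : ℕ) [NeZero n] :
    chainDP.{u} n = chainOf (ULift.{u} (Fin n)) := by
  unfold chainDP chainOf
  congr
  funext x
  by_cases h : x.down = ⊤
  · exact (if_pos h).trans (if_pos (ULift.ext _ _ h)).symm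
  · exact (if_neg h).trans (if_neg fun h' => h (congrArg ULift.down h')).symm

theorem isDStHChain_chainOf (α : Type u) [LinearOrder α] [BoundedOrder α] :
    (chainOf α).IsDStHChain := by
  have hsemi : (chainOf α).IsSemiHeyting := by
    refine ⟨⟨max_comm (α := α), min_comm (α := α), max_assoc (α := α), min_assoc (α := α),
      fun _ _ => sup_inf_self (α := α), fun _ _ => inf_sup_self (α := α),
      max_bot_right (α := α), min_top_right (α := α)⟩, ?_, ?_, ?_⟩
    · intro (x : α) (y : α)
      change min x (if x ≤ y then ⊤ else y) = min x y
      split_ifs with h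
      · rw [min_top_right, min_eq_left h]
      · rfl
    · intro (x : α) (y : α) (z : α)
      change min x (if y ≤ z then ⊤ else z) =
        min x (if min x y ≤ min x z then ⊤ else min x z)
      by_cases hyz : y ≤ z
      · rw [if_pos hyz, if_pos (min_le_min_left x hyz)]
      · rw [if_neg hyz]
        split_ifs with h
        · rw [min_top_right, min_eq_left]
          by_contra! hzx
          exact (lt_min hzx (not_le.1 hyz)).not_ge (h.trans (min_le_right x z))
        · rw [← min_assoc, min_self]
    · exact fun x : α => if_pos le_rfl
  obtain ⟨p, hp⟩ : ∃ p : α → α, p = (chainOf α).prime := ⟨_, rfl⟩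
  have p_apply (x : α) : p x = if x = ⊤ then ⊥ else ⊤ := by rw [hp]
  have p_bot : p ⊥ = ⊤ := by
    rw [p_apply]
    split_ifs with h
    exacts [h, rfl]
  have p_anti : Antitone p := by
    intro x y hxy
    rw [p_apply, p_apply]
    split_ifs with hy hx hx
    · exact le_rfl
    · exact bot_le
    · exact absurd (top_le_iff.1 (hx ▸ hxy)) hy
    · exact le_rfl
  have pp_apply (x : α) : p (p x) = if x = ⊤ then ⊤ else ⊥ := by
    rw [p_apply x]
    split_ifs
    · exact p_bot
    · rw [p_apply, if_pos rfl]
  refine ⟨⟨⟨hsemi, ?_, if_pos rfl, ?_, ?_, ?_⟩, ?_⟩, ⟨hsemi, ?_⟩, ?_⟩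
  all_goals try rw [← hp]
  · exact p_bot
  · exact fun x y => p_anti.map_min
  · exact fun x y => (p_anti.comp p_anti).map_max
  · intro (x : α)
    refine min_eq_left (α := α) ?_
    rw [pp_apply]
    split_ifs with hx
    exacts [hx.ge, bot_le]
  · intro (x : α)
    change min (p x) (p (p x)) = ⊥
    rw [pp_apply, p_apply]
    split_ifs
    exacts [min_bot_left _, min_bot_right _]
  · exact fun x y : α => if_pos (min_le_right x y)
  · exact fun x y : α => (le_total x y).imp min_eq_left min_eq_left

/-- In a dually Stone Heyting chain the order determines all operations. In particular `x'' ≤ x`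
and `x' ∧ x'' = 0` force `x' = 1` for `x ≠ 1`. -/
theorem IsDStHChain.exists_eq_chainOf (h : A.IsDStHChain) :
    ∃ (α : Type u) (_ : LinearOrder α) (_ : BoundedOrder α), A = chainOf α := by
  classical
  let i := h.heyting.heytingAlgebra
  have htot (x y : A) : x ≤ y ∨ y ≤ x := (h.total x y).imp inf_eq_left.1 inf_eq_left.1
  have himp (x y : A) : A.imp x y = if x ≤ y then ⊤ else y := by
    change x ⇨ y = _
    split_ifs with hxy
    · exact himp_eq_top_iff.2 hxy
    · refine le_antisymm ?_ le_himp
      rcases htot x (x ⇨ y) with h1 | h1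
      · exact absurd (by simpa using h1) hxy
      · calc x ⇨ y = x ⊓ (x ⇨ y) := (inf_eq_right.2 h1).symm
          _ ≤ y := inf_himp_le
  have hprime (x : A) : A.prime x = if x = ⊤ then ⊥ else ⊤ := by
    have p_bot : A.prime ⊥ = ⊤ := h.dst.prime_zero
    have pp_le (x : A) : A.prime (A.prime x) ≤ x := inf_eq_left.1 (h.dst.prime_prime_le x)
    split_ifs with hx
    · rw [hx]; exact h.dst.prime_one
    · have h0 : A.prime x ⊓ A.prime (A.prime x) = ⊥ := h.dst.dual_stone x
      rcases htot (A.prime x) (A.prime (A.prime x)) with h1 | h1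
      · rw [inf_eq_left.2 h1] at h0
        have := pp_le x
        rw [h0, p_bot] at this
        exact absurd (top_le_iff.1 this) hx
      · rw [inf_eq_right.2 h1] at h0
        have := pp_le (A.prime x)
        rw [h0, p_bot] at this
        exact top_le_iff.1 this
  let l : LinearOrder A :=
    { i with
      le_total := htot
      min := A.meet
      max := A.join
      min_def := fun x y => by
        change x ⊓ y = _
        split_ifs with hxy
        exacts [inf_eq_left.2 hxy, inf_eq_right.2 ((htot x y).resolve_left hxy)]
      max_def := fun x y => by
        change x ⊔ y = _
        split_ifs with hxy
        exacts [sup_eq_right.2 hxy, sup_eq_left.2 ((htot x y).resolve_left hxy)]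
      compare := _
      compare_eq_compareOfLessAndEq := fun _ _ => rfl
      toDecidableEq := fun _ _ => Classical.propDecidable _
      toDecidableLE := Classical.decRel _ }
  refine ⟨A, l, { i with }, ?_⟩
  exact congrArg₂ (fun f g => (⟨A, A.join, A.meet, f, g, A.zero, A.one⟩ : DAlg.{u}))
    (funext₂ himp) (funext hprime)

/-- An order embedding that preserves the bounds is a homomorphism of chains. -/
def chainOf.hom (f : α ↪o β) (hbot : f ⊥ = ⊥) (htop : f ⊤ = ⊤) :
    Hom (chainOf α) (chainOf β) where
  toFun := f
  map_join _ _ := f.monotone.map_max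
  map_meet _ _ := f.monotone.map_min
  map_imp (x y : α) := by
    change f (if x ≤ y then ⊤ else y) = if f x ≤ f y then ⊤ else f y
    simp only [f.le_iff_le]
    split_ifs
    exacts [htop, rfl]
  map_prime (x : α) := by
    change f (if x = ⊤ then ⊥ else ⊤) = if f x = ⊤ then ⊥ else ⊤
    have : f x = ⊤ ↔ x = ⊤ := by rw [← htop, f.eq_iff_eq]
    simp only [this]
    split_ifs
    exacts [hbot, htop]
  map_zero := hbot
  map_one := htop

theorem IsVariety.chainOf_mem {V : Set DAlg.{u}} (hV : IsVariety V) (f : α ↪o β)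
    (hbot : f ⊥ = ⊥) (htop : f ⊤ = ⊤) (hβ : chainOf β ∈ V) : chainOf α ∈ V :=
  hV.subalgebra _ _ (chainOf.hom f hbot htop) f.injective hβ

/-- Chains are simple: if `y < x` have the same image then so have `x → y = y` and `1`, hence also
`y' = 1` and `1' = 0`. -/
theorem chainOf.injective_or_subsingleton (f : Hom (chainOf α) B)
    (hB : B.IsPrelinear) :
    Function.Injective f.toFun ∨ Subsingleton B := by
  rw [or_iff_not_imp_left]
  intro hinj
  have key : ∀ x y : α, y < x → f.toFun x = f.toFun y → Subsingleton B := by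
    intro x y hyx hxy
    have h1 : f.toFun y = B.one := by
      have := f.map_imp x y
      rw [hxy, hB.imp_self] at this
      rw [← this]
      exact congrArg f.toFun (if_neg hyx.not_ge).symm
    have h2 : B.one = B.zero := by
      have := f.map_prime y
      rw [h1, hB.prime_one] at this
      rw [← this, ← f.map_one]
      exact congrArg f.toFun (if_neg (hyx.trans_le le_top).ne).symm
    let _ := hB.toIsHeyting.heytingAlgebra
    exact subsingleton_of_bot_eq_top (α := B) h2.symm
  simp only [Function.Injective, not_forall] at hinj
  obtain ⟨x, y, hxy, hne⟩ := hinj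
  rcases lt_or_gt_of_ne (α := α) hne with hlt | hlt
  exacts [key y x hlt hxy.symm, key x y hlt hxy]

end Chains

/-! ### Subdirectly irreducible algebras -/

theorem IsDStHChain.isSubdirectlyIrreducible (h : A.IsDStHChain) :
    A.IsSubdirectlyIrreducible := by
  intro ι B f ⟨i₀⟩ hinj hsurj
  have hprelin := h.isPrelinear
  obtain ⟨α, _, _, rfl⟩ := h.exists_eq_chainOf
  let g (i : ι) : Hom (chainOf α) (B i) :=
    { toFun := fun a => f.toFun a i
      map_join := fun x y => congrFun (f.map_join x y) i
      map_meet := fun x y => congrFun (f.map_meet x y) i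
      map_imp := fun x y => congrFun (f.map_imp x y) i
      map_prime := fun x => congrFun (f.map_prime x) i
      map_zero := congrFun f.map_zero i
      map_one := congrFun f.map_one i }
  have hg (i : ι) : Function.Injective (g i).toFun ∨ Subsingleton (B i) :=
    chainOf.injective_or_subsingleton (g i) (hprelin.image (g i) (hsurj i))
  by_cases hall : ∀ i, Subsingleton (B i)
  · refine ⟨i₀, fun a b _ => hinj (funext fun i => ?_), hsurj i₀⟩
    exact (hall i).elim _ _
  · push Not at hall
    obtain ⟨i, hi⟩ := hall
    exact ⟨i, (hg i).resolve_right (not_subsingleton_iff_nontrivial.2 hi), hsurj i⟩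

theorem IsDStHChain.of_injective (h : B.IsDStHChain) (f : Hom A B)
    (hf : Function.Injective f.toFun) : A.IsDStHChain := by
  have hA := h.isPrelinear.subalgebra f hf
  refine ⟨hA.toIsDSt, hA.toIsHeyting, fun x y => ?_⟩
  refine (h.total (f.toFun x) (f.toFun y)).imp (fun hxy => ?_) (fun hxy => ?_)
  · exact hf (by rw [f.map_meet, hxy])
  · exact hf (by rw [f.map_meet, hxy])

theorem IsPrelinear.isDStHChain (h : A.IsPrelinear) (hsi : A.IsSubdirectlyIrreducible) :
    A.IsDStHChain := by
  rcases subsingleton_or_nontrivial A with hA | ⟨a, b, hab⟩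
  · exact ⟨h.toIsDSt, h.toIsHeyting, fun x y => Or.inl (hA.elim _ _)⟩
  · choose C f hC hf hne using
      fun p : {p : A × A // p.1 ≠ p.2} => h.exists_chain_separating p.2
    obtain ⟨i, hi⟩ := hsi _ C (Hom.toPi f) ⟨⟨(a, b), hab⟩⟩ (fun x y hxy => by
      by_contra hne'
      exact hne ⟨(x, y), hne'⟩ (congrFun hxy ⟨(x, y), hne'⟩)) hf
    exact (hC i).of_injective (f i) hi.1

/-! ### Finite chains in a variety -/

section FiniteChains

variable {α β : Type u} [LinearOrder α] [BoundedOrder α] [LinearOrder β] [BoundedOrder β]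

/-- The bounded subchain of `α` on `s ∪ {⊥, ⊤}`. -/
abbrev BoundedSubchain (s : Finset α) : Type u := {x : α // x ∈ s ∨ x = ⊥ ∨ x = ⊤}

instance (s : Finset α) : BoundedOrder (BoundedSubchain s) :=
  Subtype.boundedOrder (Or.inr (Or.inl rfl)) (Or.inr (Or.inr rfl))

instance (s : Finset α) : Finite (BoundedSubchain s) :=
  (s.finite_toSet.union (Set.toFinite {⊥, ⊤})).subset fun _ hx => hx

/-- The elements of the product of all finite bounded subchains of `α` that are eventually equal to
some `a : α`, where the finite subsets of `α` are directed by inclusion. -/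
def IsEventually (x : pi fun s : Finset α => chainOf (BoundedSubchain s)) (a : α) : Prop :=
  ∀ᶠ s in Filter.atTop, (x s : α) = a

theorem IsEventually.unique {x : pi fun s : Finset α => chainOf (BoundedSubchain s)} {a b : α}
    (ha : IsEventually x a) (hb : IsEventually x b) : a = b := by
  classical
  obtain ⟨s, h1, h2⟩ := (ha.and hb).exists
  exact h1.symm.trans h2

end FiniteChains

/-- A variety that contains the finite chains contains every chain `α`: the algebra of eventually
constant elements of the product of all finite subchains of `α` is mapped onto `α` by the limit. -/
theorem IsVariety.mem_of_finite_chains {V : Set DAlg.{u}} (hV : IsVariety V)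
    (hfin : {A : DAlg.{u} | A.IsDStHChain ∧ Finite A} ⊆ V) (hA : A.IsDStHChain) : A ∈ V := by
  classical
  obtain ⟨α, _, _, rfl⟩ := hA.exists_eq_chainOf
  let Q : DAlg.{u} := pi fun s : Finset α => chainOf (BoundedSubchain s)
  have hQ : Q ∈ V := hV.product _ _ fun s => hfin ⟨isDStHChain_chainOf _, inferInstance⟩
  have join {x y : Q} {a b : α} (hx : IsEventually x a) (hy : IsEventually y b) :
      IsEventually (Q.join x y) ((chainOf α).join a b) := by
    filter_upwards [hx, hy] with s hs ht
    rw [← hs, ← ht]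
    exact (Subtype.mono_coe _).map_max
  have meet {x y : Q} {a b : α} (hx : IsEventually x a) (hy : IsEventually y b) :
      IsEventually (Q.meet x y) ((chainOf α).meet a b) := by
    filter_upwards [hx, hy] with s hs ht
    rw [← hs, ← ht]
    exact (Subtype.mono_coe _).map_min
  let ι (s : Finset α) : Hom (chainOf (BoundedSubchain s)) (chainOf α) :=
    chainOf.hom (OrderEmbedding.subtype _) rfl rfl
  have imp {x y : Q} {a b : α} (hx : IsEventually x a) (hy : IsEventually y b) :
      IsEventually (Q.imp x y) ((chainOf α).imp a b) := by
    filter_upwards [hx, hy] with s hs ht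
    rw [← hs, ← ht]
    exact (ι s).map_imp _ _
  have prime {x : Q} {a : α} (hx : IsEventually x a) :
      IsEventually (Q.prime x) ((chainOf α).prime a) := by
    filter_upwards [hx] with s hs
    rw [← hs]
    exact (ι s).map_prime _
  have zero : IsEventually Q.zero (⊥ : α) := Filter.Eventually.of_forall fun s => rfl
  have one : IsEventually Q.one (⊤ : α) := Filter.Eventually.of_forall fun s => rfl
  let S : DAlg.{u} :=
    { carrier := {x : Q // ∃ a : α, IsEventually x a}
      join := fun x y => ⟨Q.join x.1 y.1, _, join x.2.choose_spec y.2.choose_spec⟩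
      meet := fun x y => ⟨Q.meet x.1 y.1, _, meet x.2.choose_spec y.2.choose_spec⟩
      imp := fun x y => ⟨Q.imp x.1 y.1, _, imp x.2.choose_spec y.2.choose_spec⟩
      prime := fun x => ⟨Q.prime x.1, _, prime x.2.choose_spec⟩
      zero := ⟨Q.zero, _, zero⟩
      one := ⟨Q.one, _, one⟩ }
  let incl : Hom S Q :=
    { toFun := Subtype.val
      map_join := fun _ _ => rfl
      map_meet := fun _ _ => rfl
      map_imp := fun _ _ => rfl
      map_prime := fun _ => rfl
      map_zero := rfl
      map_one := rfl }
  have hS : S ∈ V := hV.subalgebra S Q incl Subtype.val_injective hQ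
  have spec (x : S) : IsEventually x.1 x.2.choose := x.2.choose_spec
  let lim : Hom S (chainOf α) :=
    { toFun := fun x => x.2.choose
      map_join := fun x y => (spec (S.join x y)).unique (join (spec x) (spec y))
      map_meet := fun x y => (spec (S.meet x y)).unique (meet (spec x) (spec y))
      map_imp := fun x y => (spec (S.imp x y)).unique (imp (spec x) (spec y))
      map_prime := fun x => (spec (S.prime x)).unique (prime (spec x))
      map_zero := (spec S.zero).unique zero
      map_one := (spec S.one).unique one }
  refine hV.image S _ lim (fun a => ?_) hS
  let x : Q := fun s => if h : a ∈ s then ⟨a, Or.inl h⟩ else ⊥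
  have hx : IsEventually x a := by
    filter_upwards [Filter.eventually_ge_atTop {a}] with s hs
    have ha : a ∈ s := hs (Finset.mem_singleton_self a)
    exact congrArg Subtype.val (dif_pos ha)
  exact ⟨⟨x, a, hx⟩, (spec ⟨x, a, hx⟩).unique hx⟩

theorem DStHC_eq_varietyGen_finite :
    DStHC.{u} = varietyGen {A | A.IsDStHChain ∧ Finite A} := by
  refine (varietyGen_subset (isVariety_varietyGen _) fun A hA => ?_).antisymm
    (varietyGen_subset (isVariety_varietyGen _) fun A hA => subset_varietyGen _ hA.1)
  exact (isVariety_varietyGen _).mem_of_finite_chains (subset_varietyGen _) hA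

section FiniteChains

variable {α β : Type u} [LinearOrder α] [BoundedOrder α] [LinearOrder β] [BoundedOrder β]

theorem isDStHChain_chainDP (n : ℕ) [NeZero n] : (chainDP.{u} n).IsDStHChain :=
  chainDP_eq_chainOf n ▸ isDStHChain_chainOf _

theorem IsVariety.chainOf_mem_of_chainDP_mem {V : Set DAlg.{u}} (hV : IsVariety V) {n : ℕ}
    [Finite α] (hn : Nat.card α = n + 1) (h : chainDP.{u} (n + 1) ∈ V) : chainOf α ∈ V := by
  have := Fintype.ofFinite α
  rw [chainDP_eq_chainOf] at h
  let e : α ≃o ULift.{u} (Fin (n + 1)) :=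
    (Fintype.orderIsoFinOfCardEq α (Nat.card_eq_fintype_card.symm.trans hn)).symm.trans
      ULift.orderIso.symm
  exact hV.chainOf_mem e.toOrderEmbedding e.map_bot e.map_top h

/-- A chain with at least `n + 1` elements contains the `(n + 1)`-element chain as a subalgebra,
unless `n = 0`, when this chain is a trivial algebra. -/
theorem IsVariety.chainDP_mem {V : Set DAlg.{u}} (hV : IsVariety V) {n : ℕ}
    (hn : (n + 1 : ℕ) ≤ ENat.card α) (h : chainOf α ∈ V) : chainDP.{u} (n + 1) ∈ V := by
  classical
  cases n with
  | zero =>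
    have : Subsingleton (chainDP.{u} (0 + 1)) := inferInstanceAs (Subsingleton (ULift (Fin 1)))
    exact hV.mem_of_subsingleton
  | succ n =>
    obtain ⟨t, hst, ht⟩ : ∃ t : Finset α, {⊥, ⊤} ⊆ t ∧ t.card = n + 2 := by
      have hcard : ({⊥, ⊤} : Finset α).card ≤ n + 2 := Finset.card_le_two.trans (by omega)
      rcases finite_or_infinite α with hα | hα
      · have := Fintype.ofFinite α
        refine Finset.exists_superset_card_eq hcard ?_
        rw [ENat.card_eq_coe_fintype_card] at hn
        exact_mod_cast hn
      · exact Infinite.exists_superset_card_eq _ _ hcard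
    let e := ULift.orderIso.trans (t.orderIsoOfFin ht)
    rw [chainDP_eq_chainOf]
    refine hV.chainOf_mem (e.toOrderEmbedding.trans (OrderEmbedding.subtype _)) ?_ ?_ h
    · have hb : (⊥ : α) ∈ t := hst (by simp)
      refine le_bot_iff.1 ?_
      change (e ⊥ : α) ≤ (⟨⊥, hb⟩ : t)
      rw [← e.apply_symm_apply ⟨⊥, hb⟩]
      exact e.monotone bot_le
    · have hb : (⊤ : α) ∈ t := hst (by simp)
      refine top_le_iff.1 ?_
      change ((⟨⊤, hb⟩ : t) : α) ≤ (e ⊤ : α)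
      rw [← e.apply_symm_apply ⟨⊤, hb⟩]
      exact e.monotone le_top

theorem IsVariety.chainDP_mem_of_le {V : Set DAlg.{u}} (hV : IsVariety V) {m n : ℕ} (hmn : m ≤ n)
    (h : chainDP.{u} (n + 1) ∈ V) : chainDP.{u} (m + 1) ∈ V := by
  rw [chainDP_eq_chainOf (n + 1)] at h
  refine hV.chainDP_mem ?_ h
  rw [ENat.card_eq_coe_fintype_card, Fintype.card_ulift, Fintype.card_fin]
  exact_mod_cast Nat.succ_le_succ hmn

/-! ### Bounding the length of chains by an identity -/

/-- The term `(x₀ → x₁) ∨ (x₁ → x₂) ∨ ⋯ ∨ (xₙ₋₁ → xₙ)`. It takes the value `1` everywhere on a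
chain, for `n ≥ 1`, if and only if there is no descent `x₀ > x₁ > ⋯ > xₙ`. -/
def descent (A : DAlg.{u}) (x : ℕ → A) : ℕ → A
  | 0 => A.zero
  | n + 1 => A.join (descent A x n) (A.imp (x n) (x (n + 1)))

theorem Hom.map_descent (f : Hom A B) (x : ℕ → A) (n : ℕ) :
    f.toFun (A.descent x n) = B.descent (fun i => f.toFun (x i)) n := by
  induction n with
  | zero => exact f.map_zero
  | succ n ih => rw [descent, descent, f.map_join, f.map_imp, ih]

theorem pi_descent {ι : Type u} (A : ι → DAlg.{u}) (x : ℕ → pi A) (n : ℕ) (i : ι) :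
    (pi A).descent x n i = (A i).descent (fun k => x k i) n := by
  induction n with
  | zero => rfl
  | succ n ih => exact congrArg₂ (A i).join ih rfl

theorem isVariety_descent (n : ℕ) :
    IsVariety {A : DAlg.{u} | ∀ x : ℕ → A, A.descent x n = A.one} where
  image A B f hf h y := by
    choose g hg using hf
    rw [← f.map_one, ← h fun i => g (y i), f.map_descent]
    simp only [hg]
  subalgebra A B f hf h x := hf (by rw [f.map_descent, f.map_one]; exact h _)
  product ι A h x := funext fun i => by rw [pi_descent]; exact h i _

theorem descent_chainOf_eq_top (x : ℕ → α) {n : ℕ} (h : (⊥ : α) ≠ ⊤) :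
    (chainOf α).descent x n = (⊤ : α) ↔ ∃ i < n, x i ≤ x (i + 1) := by
  induction n with
  | zero => simpa [descent] using h
  | succ n ih =>
    have himp : (chainOf α).imp (x n) (x (n + 1)) = (⊤ : α) ↔ x n ≤ x (n + 1) := by
      change (if x n ≤ x (n + 1) then ⊤ else x (n + 1)) = (⊤ : α) ↔ _
      split_ifs with h1
      · simpa using h1
      · simp only [h1, iff_false]
        intro h2
        exact h1 (h2 ▸ le_top)
    have hmax (a b : α) : max a b = ⊤ ↔ a = ⊤ ∨ b = ⊤ := by
      refine ⟨fun h => ?_, ?_⟩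
      · rcases max_choice a b with h1 | h1
        exacts [Or.inl (h1 ▸ h), Or.inr (h1 ▸ h)]
      · rintro (rfl | rfl)
        exacts [max_top_left _, max_top_right _]
    rw [descent]
    refine (hmax _ _).trans ?_
    rw [ih, himp]
    constructor
    · rintro (⟨i, hi, h1⟩ | h1)
      exacts [⟨i, hi.trans n.lt_succ_self, h1⟩, ⟨n, n.lt_succ_self, h1⟩]
    · rintro ⟨i, hi, h1⟩
      rcases Nat.lt_succ_iff_lt_or_eq.1 hi with h2 | rfl
      exacts [Or.inl ⟨i, h2, h1⟩, Or.inr h1]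

theorem chainDP_notMem_varietyGen (n : ℕ) :
    chainDP.{u} (n + 2) ∉ varietyGen {chainDP.{u} (n + 1)} := by
  intro hmem
  have hsub : varietyGen {chainDP.{u} (n + 1)} ⊆
      {A | ∀ x : ℕ → A, A.descent x (n + 1) = A.one} := by
    refine varietyGen_subset (isVariety_descent _) ?_
    rintro _ rfl
    rw [chainDP_eq_chainOf]
    intro (x : ℕ → ULift (Fin (n + 1)))
    change _ = (⊤ : ULift (Fin (n + 1)))
    by_cases hbt : (⊥ : ULift (Fin (n + 1))) = ⊤
    · have := subsingleton_of_bot_eq_top hbt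
      exact Subsingleton.elim (α := ULift (Fin (n + 1))) _ _
    · rw [descent_chainOf_eq_top x hbt]
      by_contra! hcon
      -- A descent of length `n + 1` passes through `n + 2` elements.
      have hanti : StrictAnti fun i : Fin (n + 2) => x i := by
        rw [Fin.strictAnti_iff_succ_lt]
        exact fun i => hcon i i.2
      simpa using Fintype.card_le_of_injective _ hanti.injective
  have h := hsub hmem
  rw [chainDP_eq_chainOf] at h
  have hbt : (⊥ : ULift.{u} (Fin (n + 2))) ≠ ⊤ := fun h0 => by
    simpa using congrArg ULift.down h0
  obtain ⟨i, hi, hle⟩ := (descent_chainOf_eq_top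
    (fun i => (⟨Fin.rev (Fin.ofNat (n + 2) i)⟩ : ULift.{u} (Fin (n + 2)))) hbt).1 (h _)
  rw [ULift.up_le, Fin.rev_le_rev, Fin.le_def] at hle
  simp only [Fin.ofNat] at hle
  rw [Nat.mod_eq_of_lt (by omega), Nat.mod_eq_of_lt (by omega)] at hle
  omega

end FiniteChains

/-! ### The lattice of subvarieties -/

theorem IsVariety.eq_DStHC {V : Set DAlg.{u}} (hV : IsVariety V) (hsub : V ⊆ DStHC)
    (h : ∀ n : ℕ, chainDP.{u} (n + 1) ∈ V) : V = DStHC := by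
  refine hsub.antisymm (varietyGen_subset hV fun A hA => hV.mem_of_finite_chains ?_ hA)
  rintro A ⟨hA, hfin⟩
  obtain ⟨α, _, _, rfl⟩ := hA.exists_eq_chainOf
  have : Finite α := hfin
  obtain ⟨n, hn⟩ := Nat.exists_eq_succ_of_ne_zero (Nat.card_pos (α := α)).ne'
  exact hV.chainOf_mem_of_chainDP_mem hn (h n)

/-- A subvariety is determined by its chains, and a variety that omits the `(n + 2)`-element chain
omits all longer chains. -/
theorem IsVariety.eq_varietyGen_chainDP {V : Set DAlg.{u}} (hV : IsVariety V) (hsub : V ⊆ DStHC)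
    {n : ℕ} (h : chainDP.{u} (n + 1) ∈ V) (h' : chainDP.{u} (n + 2) ∉ V) :
    V = varietyGen {chainDP.{u} (n + 1)} := by
  refine Set.Subset.antisymm (fun A hA => ?_)
    (varietyGen_subset hV (Set.singleton_subset_iff.2 h))
  have hW := isVariety_varietyGen {chainDP.{u} (n + 1)}
  refine hW.mem_of_separated fun a b hab => ?_
  have hA' : A.IsPrelinear := by
    have := hsub hA
    rwa [DStHC_eq_isPrelinear] at this
  obtain ⟨C, f, hC, hf, hne⟩ := hA'.exists_chain_separating hab
  refine ⟨C, ?_, f, hne⟩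
  have hCV : C ∈ V := hV.image A C f hf hA
  obtain ⟨α, _, _, rfl⟩ := hC.exists_eq_chainOf
  have hcard : ENat.card α < (n + 2 : ℕ) := by
    by_contra! hcon
    exact h' (hV.chainDP_mem hcon hCV)
  have hfin : Finite α := ENat.card_lt_top.1 (hcard.trans_le le_top)
  obtain ⟨m, hm⟩ := Nat.exists_eq_succ_of_ne_zero (Nat.card_pos (α := α)).ne'
  rw [ENat.card_eq_coe_natCard, hm, Nat.cast_lt] at hcard
  exact hW.chainOf_mem_of_chainDP_mem hm
    (hW.chainDP_mem_of_le (by omega) (subset_varietyGen _ rfl))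

/-- The enumeration of the subvarieties of `DStHC`; the index `n` stands for the variety
generated by the `(n + 1)`-element chain. -/
def subvarietyOf : WithTop ℕ → Subvariety DStHC.{u}
  | ⊤ => ⟨DStHC, isVariety_varietyGen _, subset_rfl⟩
  | (n : ℕ) => ⟨varietyGen {chainDP (n + 1)}, isVariety_varietyGen _,
      varietyGen_subset (isVariety_varietyGen _)
        (Set.singleton_subset_iff.2 (subset_varietyGen _ (isDStHChain_chainDP _)))⟩

theorem subvarietyOf_strictMono : StrictMono subvarietyOf.{u} := by
  have hsucc (n : ℕ) : subvarietyOf.{u} n < subvarietyOf.{u} (n + 1 : ℕ) := by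
    refine lt_of_le_not_ge ?_ fun hle => ?_
    · exact varietyGen_subset (isVariety_varietyGen _) (Set.singleton_subset_iff.2
        ((isVariety_varietyGen _).chainDP_mem_of_le n.le_succ (subset_varietyGen _ rfl)))
    · exact chainDP_notMem_varietyGen n (hle (subset_varietyGen _ rfl))
  have hnat : StrictMono fun n : ℕ => subvarietyOf.{u} n := strictMono_nat_of_lt_succ hsucc
  have htop (m : WithTop ℕ) : subvarietyOf.{u} m ≤ subvarietyOf ⊤ := (subvarietyOf m).2.2
  intro a b hab
  induction a with
  | top => exact absurd hab not_top_lt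
  | coe m =>
    induction b with
    | top => exact (hsucc m).trans_le (htop _)
    | coe n => exact hnat (WithTop.coe_lt_coe.1 hab)

theorem subvarietyOf_surjective : Function.Surjective subvarietyOf.{u} := by
  classical
  rintro ⟨V, hV, hsub⟩
  by_cases hall : ∀ n : ℕ, chainDP.{u} (n + 1) ∈ V
  · exact ⟨⊤, Subtype.ext (hV.eq_DStHC hsub hall).symm⟩
  · push Not at hall
    have hmin : ∀ m < Nat.find hall, chainDP.{u} (m + 1) ∈ V := fun m hm =>
      not_not.1 (Nat.find_min hall hm)
    have hfind := Nat.find_spec hall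
    generalize Nat.find hall = k at hmin hfind
    cases k with
    | zero =>
      have : Subsingleton (chainDP.{u} (0 + 1)) := inferInstanceAs (Subsingleton (ULift (Fin 1)))
      exact absurd hV.mem_of_subsingleton hfind
    | succ n =>
      exact ⟨n, Subtype.ext (hV.eq_varietyGen_chainDP hsub (hmin n n.lt_succ_self) hfind).symm⟩

end DAlg

theorem theorem4p6 :
    (∃ e : WithTop ℕ ≃o DAlg.Subvariety DAlg.DStHC.{u},
      (∀ n : ℕ, (e (n : WithTop ℕ)).1 = DAlg.varietyGen {DAlg.chainDP.{u} (n + 1)}) ∧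
      (e ⊤).1 = DAlg.DStHC.{u}) ∧
    (∀ A ∈ DAlg.DStHC.{u}, A.IsSubdirectlyIrreducible ↔ A.IsDStHChain) ∧
    DAlg.DStHC.{u} = DAlg.varietyGen {A | A.IsDStHChain ∧ Finite A} := by
  refine ⟨⟨DAlg.subvarietyOf_strictMono.orderIsoOfSurjective _ DAlg.subvarietyOf_surjective,
    fun n => rfl, rfl⟩, fun A hA => ⟨fun h => ?_, fun h => h.isSubdirectlyIrreducible⟩,
    DAlg.DStHC_eq_varietyGen_finite⟩
  rw [DAlg.DStHC_eq_isPrelinear] at hA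
  exact DAlg.IsPrelinear.isDStHChain hA h
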